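/- Let $K$ be an algebraically closed field with characteristic exponent $p$ (so $p=1$ if $\operatorname{char} K=0$, and $p=\operatorname{char} K$ otherwise). Let $d$ be a nonnegative integer such that $d\notin\{0\cdot p^k,\ 1\cdot p^k,\ 2\cdot p^k\}$ for every integer $k\ge 0$, and let $r\ge 0$ be an integer. For a vector space $V$ over $K$ let $S^dV$ be its $d$-th symmetric power, the quotient of $V^{\otimes d}$ by the span of all $T-\sigma(T)$ with $T\in V^{\otimes d}$, $\sigma\in S_d$; write $v_1\cdots v_d$ for the image of $v_1\otimes\cdots\otimes v_d$. For a subspace $U \subseteq V$, regard $S^dU$ as a subspace of $S^dV$. An element $f\in S^dV$ is regarded as a homogeneous polynomial on $V^*$, where $v_1\cdots v_d$ takes the value $\xi(v_1)\cdots\xi(v_d)$ at $\xi\in V^*$. For $V$ finite-dimensional, the slice rank of $f$ is the minimal codimension of a (possibly empty) linear subspace of $\mathbb{P}V^*$ on which $f$ vanishes identically, that is, the minimal codimension of a linear subspace of $V^*$ on which $f$ vanishes identically. Let $e_1,\dots,e_r$ be the standard basis of $K^r$ and let $I_r := e_1^d+\dots+e_r^d\in S^dK^r$ be the $r$-th unit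 tensor. Then: 1. $I_r\notin S^dU$ for every proper linear subspace $U\subsetneq K^r$; 2. the slice rank of $I_r$ equals $\lceil r/2\rceil$; 3. the orbit $\operatorname{GL}_r\cdot I_r\subseteq S^dK^r$, under the action $g\cdot(v_1\cdots v_d)=(gv_1)\cdots(gv_d)$, has dimension $r^2$. Here the dimension of the orbit, a locally closed subset of $S^dK^r$, is that of its Zariski closure, i.e. the Krull dimension of the ring of polynomial functions on it. -/

import Mathlib

universe u v w

namespace SymSubrank

/-- The `d`-th symmetric power `S^d V`: the quotient of `V^{⊗ d}` by permutations of the factors.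
(`ULift` only adjusts the universe of the index type `Fin d`, since Mathlib's `SymmetricPower`
wants it in the universe of `K`.) -/
abbrev SymPow (K : Type u) [Field K] (d : ℕ) (V : Type v) [AddCommGroup V] [Module K V] :
    Type (max u v) :=
  SymmetricPower K (ULift.{u} (Fin d)) V

section Lift

variable {K : Type u} [Field K] {d : ℕ} {V : Type v} [AddCommGroup V] [Module K V]
  {W : Type w} [AddCommGroup W] [Module K W]

/-- The simple symmetric tensor `v_1 v_2 ⋯ v_d`. -/
noncomputable def simple (K : Type u) [Field K] {V : Type v} [AddCommGroup V] [Module K V] {d : ℕ}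
    (v : Fin d → V) : SymPow K d V :=
  SymmetricPower.tprod K fun i => v i.down

/-- The linear map on `S^d V` induced by a symmetric multilinear map. -/
noncomputable def lift (m : MultilinearMap K (fun _ : ULift.{u} (Fin d) => V) W)
    (hm : ∀ (e : Equiv.Perm (ULift.{u} (Fin d))) (v : ULift.{u} (Fin d) → V),
      m (fun i => v (e i)) = m v) :
    SymPow K d V →ₗ[K] W :=
  let f : SymPow K d V →+ W :=
    AddCon.lift (addConGen (SymmetricPower.Rel K (ULift.{u} (Fin d)) V))
      (PiTensorProduct.lift m).toAddMonoidHom (AddCon.addConGen_le.2 (by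
        rintro _ _ ⟨e, v⟩
        simp [AddCon.ker_rel, hm e v]))
  { f with
    map_smul' := fun c x => AddCon.induction_on x fun y =>
      (PiTensorProduct.lift m).map_smul c y }

theorem lift_simple (m : MultilinearMap K (fun _ : ULift.{u} (Fin d) => V) W)
    (hm : ∀ (e : Equiv.Perm (ULift.{u} (Fin d))) (v : ULift.{u} (Fin d) → V),
      m (fun i => v (e i)) = m v) (v : Fin d → V) :
    lift m hm (simple K v) = m fun i => v i.down :=
  PiTensorProduct.lift.tprod _

/-- The linear map `S^d V → S^d W`, `v_1 ⋯ v_d ↦ φ(v_1) ⋯ φ(v_d)`, induced by a linear map `φ`. -/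
noncomputable def map (d : ℕ) (φ : V →ₗ[K] W) : SymPow K d V →ₗ[K] SymPow K d W :=
  lift ((SymmetricPower.tprod K).compLinearMap fun _ => φ) fun e v =>
    SymmetricPower.tprod_equiv e fun i => φ (v i)

theorem map_simple (φ : V →ₗ[K] W) (v : Fin d → V) :
    map d φ (simple K v) = simple K fun i => φ (v i) :=
  lift_simple _ _ v

/-- The value of a symmetric tensor at the point `ξ` of `V*`; a symmetric tensor is viewed as
a homogeneous polynomial on `V*`, with `v_1 ⋯ v_d` taking the value `ξ(v_1) ⋯ ξ(v_d)`. -/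
noncomputable def eval (ξ : Module.Dual K V) : SymPow K d V →ₗ[K] K :=
  lift ((MultilinearMap.mkPiAlgebra K (ULift.{u} (Fin d)) K).compLinearMap fun _ => ξ)
    fun e v => by simpa using Equiv.prod_comp e fun i => ξ (v i)

theorem eval_simple (ξ : Module.Dual K V) (v : Fin d → V) :
    eval ξ (simple K v) = ∏ i, ξ (v i) :=
  (lift_simple _ _ v).trans (by
    simpa using Equiv.prod_comp (Equiv.ulift.{u} (α := Fin d)) fun i => ξ (v i))

/-- The subset `S^d U ⊆ S^d V` for a subspace `U ⊆ V`, as the image of `S^d U → S^d V`. -/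
noncomputable def symPowOf (d : ℕ) (U : Submodule K V) : Submodule K (SymPow K d V) :=
  LinearMap.range (map d U.subtype)

/-- The slice rank of `f ∈ S^d V`: the minimal codimension of a linear subspace of `ℙ V*` on which
`f` vanishes identically. Linear subspaces of `ℙ V*` are given by linear subspaces `L` of `V*` (the
empty one by `L = 0`), with the same codimension. The infimum is `⊤` if there is no such `L`. -/
noncomputable def sliceRank [FiniteDimensional K V] (f : SymPow K d V) : ℕ∞ :=
  ⨅ (L : Submodule K (Module.Dual K V)) (_ : ∀ ξ ∈ L, eval ξ f = 0),
    (Module.finrank K (Module.Dual K V ⧸ L) : ℕ∞)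

/-- The orbit of `f ∈ S^d V` under the action of `GL(V)`. -/
def glOrbit (f : SymPow K d V) : Set (SymPow K d V) :=
  {h | ∃ g : V ≃ₗ[K] V, h = map d g.toLinearMap f}

/-- The `K`-algebra of polynomial functions on a subset `S` of a vector space `W`: the functions
`S → K` that are polynomials in restrictions of linear forms on `W`. For `W` finite-dimensional this
is `K[W] / I(S)`, the coordinate ring of the Zariski closure of `S`. -/
def polyFunctions (S : Set W) : Subalgebra K (S → K) :=
  Algebra.adjoin K (Set.range fun (ℓ : Module.Dual K W) (x : S) => ℓ x.1)

/-- The dimension of a subset `S` of a finite-dimensional vector space `W` over an algebraically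
closed field, as used for locally closed (more generally constructible) sets: the dimension of the
Zariski closure of `S`, i.e. the Krull dimension of its coordinate ring. -/
noncomputable def varietyDim (K : Type u) [Field K] {W : Type w} [AddCommGroup W] [Module K W]
    (S : Set W) : WithBot ℕ∞ :=
  ringKrullDim (polyFunctions (K := K) S)

end Lift

/-- The `r`-th unit tensor `I_r = e_1^d + ⋯ + e_r^d ∈ S^d K^r`. -/
noncomputable def unitTensor (K : Type u) [Field K] (d r : ℕ) : SymPow K d (Fin r → K) :=
  ∑ i : Fin r, simple K fun _ : Fin d => (Pi.single i 1 : Fin r → K)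

end SymSubrank

namespace SymSubrank

/-! Write d = qm with q = p^a, m invertible in K and m ≥ 3. The q-th power map is additive and
bijective on K, so power sums of degree d behave like power sums of degree m; in particular no
nonzero translation preserves one (`eq_zero_of_forall_sum_add_pow_eq`). This gives claim 1, since an
element of S^dU is invariant under translation by functionals killing U. It also gives the lower
bound in claim 2: if dim L > r/2, coordinates forming a basis of L* leave fewer than dim L others,
so some nonzero v in L kills the others and translates the power sum in the basis coordinates into
itself. Pairing coordinates by a d-th root of -1 gives the upper bound. For claim 3, functions on
the orbit pull back injectively to polynomials in r² matrix entries. Conversely, the t^q-coefficient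
of M·I_r at e_i* + t e_j* is m(∑_k M_ik^(m-1) M_jk)^q. The inner sums have invertible differential
at M = 1, so these r² functions are algebraically independent. Only here is m ≥ 3 rather than m ≥ 2
needed: for m = 2 the sums are symmetric in i and j. -/

/-- A `d` that is neither `0` nor of the form `p ^ k` or `2 * p ^ k` is `p ^ a * m`
with `m ≥ 3` invertible. -/
theorem exists_eq_expChar_pow_mul (K : Type*) [Field K] (p : ℕ) [hp : ExpChar K p] {d : ℕ}
    (hd : ∀ k : ℕ, d ≠ p ^ k * 0 ∧ d ≠ p ^ k * 1 ∧ d ≠ p ^ k * 2) :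
    ∃ a m : ℕ, d = p ^ a * m ∧ 3 ≤ m ∧ (m : K) ≠ 0 := by
  have key : ∃ a m : ℕ, d = p ^ a * m ∧ (m : K) ≠ 0 := by
    have h0 : d ≠ 0 := by simpa using (hd 0).1
    cases hp with
    | zero => exact ⟨0, d, by simp, by exact_mod_cast h0⟩
    | prime hprime =>
      obtain ⟨a, m, hm, rfl⟩ := Nat.exists_eq_pow_mul_and_not_dvd h0 p hprime.ne_one
      exact ⟨a, m, rfl, by rwa [Ne, CharP.cast_eq_zero_iff K p]⟩
  obtain ⟨a, m, h, hm⟩ := key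
  refine ⟨a, m, h, ?_, hm⟩
  obtain ⟨h0, h1, h2⟩ := hd a
  by_contra! hlt
  interval_cases m <;> contradiction

/-! ### Power sums and translations. -/

section Rigidity

variable {K : Type*} [Field K] [IsAlgClosed K] (p : ℕ) [ExpChar K p] {a m : ℕ}

-- Every x in K is some s^q, so the hypothesis becomes (X + c^q)^m = X^m + b. Differentiating at 0
-- gives m c^(q(m-1)) = 0.
open Polynomial in
theorem eq_zero_of_forall_add_pow_eq (hm : 2 ≤ m) (hmK : (m : K) ≠ 0) {b c : K}
    (h : ∀ s : K, (s + c) ^ (p ^ a * m) = s ^ (p ^ a * m) + b) : c = 0 := by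
  have hq : 0 < p ^ a := pow_pos (expChar_pos K p) a
  have hpoly : (X + C (c ^ p ^ a)) ^ m = X ^ m + C b := by
    refine Polynomial.funext fun x => ?_
    obtain ⟨s, rfl⟩ := IsAlgClosed.exists_pow_nat_eq x hq
    simpa [← pow_mul, ← add_pow_expChar_pow] using h s
  have hder := congrArg (fun P => (derivative P).eval 0) hpoly
  have hm1 : m - 1 ≠ 0 := by omega
  simpa [derivative_pow, hmK, hm1, expChar_ne_zero K p] using hder

/-- The power sum of degree `p ^ a * m` is not invariant under any nontrivial translation. -/
theorem eq_zero_of_forall_sum_add_pow_eq {ι : Type*} [Fintype ι] (hm : 2 ≤ m)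
    (hmK : (m : K) ≠ 0) {v : ι → K}
    (h : ∀ η : ι → K, ∑ i, (η i + v i) ^ (p ^ a * m) = ∑ i, η i ^ (p ^ a * m)) : v = 0 := by
  classical
  have hd : p ^ a * m ≠ 0 := mul_ne_zero (pow_pos (expChar_pos K p) a).ne' (by omega)
  funext i
  refine eq_zero_of_forall_add_pow_eq p hm hmK (a := a)
    (b := -∑ j ∈ Finset.univ.erase i, v j ^ (p ^ a * m)) fun s => ?_
  -- Along the i-th axis all other coordinates contribute only the constant -b.
  have hs := h (Pi.single i s)
  rw [← Finset.add_sum_erase _ _ (Finset.mem_univ i),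
    ← Finset.add_sum_erase _ (fun j => (Pi.single i s : ι → K) j ^ _) (Finset.mem_univ i)] at hs
  have h1 : ∑ j ∈ Finset.univ.erase i, ((Pi.single i s : ι → K) j + v j) ^ (p ^ a * m) =
      ∑ j ∈ Finset.univ.erase i, v j ^ (p ^ a * m) :=
    Finset.sum_congr rfl fun j hj => by simp [Pi.single_eq_of_ne (Finset.ne_of_mem_erase hj)]
  have h2 : ∑ j ∈ Finset.univ.erase i, (Pi.single i s : ι → K) j ^ (p ^ a * m) = 0 :=
    Finset.sum_eq_zero fun j hj => by simp [Pi.single_eq_of_ne (Finset.ne_of_mem_erase hj), hd]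
  rw [h1, h2, Pi.single_eq_same] at hs
  linear_combination hs

end Rigidity

/-! ### Conciseness of the unit tensor. -/

section Concise

variable {K : Type u} [Field K]

theorem eval_map {V : Type*} [AddCommGroup V] [Module K V] {W : Type*} [AddCommGroup W]
    [Module K W] {d : ℕ} (φ : V →ₗ[K] W) (ξ : Module.Dual K W) (x : SymPow K d V) :
    eval ξ (map d φ x) = eval (ξ ∘ₗ φ) x := by
  suffices h : eval ξ ∘ₗ map d φ = eval (ξ ∘ₗ φ) from LinearMap.congr_fun h x
  refine LinearMap.ext_on_range (SymmetricPower.span_tprod_eq_top K _ V) fun w => ?_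
  have hw : SymmetricPower.tprod K w = simple K fun i : Fin d => w ⟨i⟩ := rfl
  rw [hw, LinearMap.comp_apply, map_simple, eval_simple, eval_simple]
  rfl

theorem eval_unitTensor {d r : ℕ} (ξ : Module.Dual K (Fin r → K)) :
    eval ξ (unitTensor K d r) = ∑ i, ξ (Pi.single i 1) ^ d := by
  simp [unitTensor, eval_simple]

theorem unitTensor_notMem_symPowOf [IsAlgClosed K] (p : ℕ) [ExpChar K p] {a m : ℕ} (hm : 2 ≤ m)
    (hmK : (m : K) ≠ 0) {r : ℕ} {U : Submodule K (Fin r → K)} (hU : U ≠ ⊤) :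
    unitTensor K (p ^ a * m) r ∉ symPowOf (p ^ a * m) U := by
  rintro ⟨x, hx⟩
  obtain ⟨w, -, hw⟩ := SetLike.exists_of_lt hU.lt_top
  obtain ⟨ξ, hξ, hker⟩ := Submodule.exists_le_ker_of_notMem hw
  refine hξ ?_
  have hv : (fun i => ξ (Pi.single i 1)) = (0 : Fin r → K) := by
    refine eq_zero_of_forall_sum_add_pow_eq p (a := a) hm hmK fun η => ?_
    set ζ : Module.Dual K (Fin r → K) := Fintype.linearCombination K η with hζ
    have h1 : (ζ + ξ) ∘ₗ U.subtype = ζ ∘ₗ U.subtype := by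
      ext u
      simpa using LinearMap.mem_ker.1 (hker u.2)
    have h2 : eval (ζ + ξ) (unitTensor K (p ^ a * m) r) = eval ζ (unitTensor K (p ^ a * m) r) := by
      rw [← hx, eval_map, eval_map, h1]
    simpa [eval_unitTensor, hζ, Fintype.linearCombination_apply_single] using h2
  have hξ0 : ξ = 0 := LinearMap.pi_ext' fun i => LinearMap.ext_ring (by simpa using congrFun hv i)
  simp [hξ0]

end Concise

/-! ### Slice rank. -/

section SliceRank

variable {K : Type*} [Field K] [IsAlgClosed K] (p : ℕ) [ExpChar K p] {a m : ℕ}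

/-- A linear space on which a power sum of `r` linear coordinates vanishes has dimension at most
`r / 2`. -/
theorem two_mul_finrank_le_of_forall_sum_pow_eq_zero (hm : 2 ≤ m) (hmK : (m : K) ≠ 0) {r : ℕ}
    {L : Type*} [AddCommGroup L] [Module K L] [FiniteDimensional K L]
    (X : L →ₗ[K] (Fin r → K)) (hX : Function.Injective X)
    (h : ∀ ξ : L, ∑ i, X ξ i ^ (p ^ a * m) = 0) : 2 * Module.finrank K L ≤ r := by
  classical
  let x : Fin r → Module.Dual K L := fun i => LinearMap.proj i ∘ₗ X
  change ∀ ξ : L, ∑ i, x i ξ ^ (p ^ a * m) = 0 at h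
  have hx : ∀ ξ : L, (∀ i, x i ξ = 0) → ξ = 0 := fun ξ hξ =>
    (injective_iff_map_eq_zero X).1 hX ξ (funext hξ)
  -- A maximal independent set `s` of coordinate forms is a basis of the dual of `L`.
  obtain ⟨s, -, -, hsp, hli⟩ := exists_linearIndepOn_extension (K := K) (v := x) (s := ∅)
    (t := Set.univ) (linearIndepOn_empty K x) (Set.empty_subset _)
  let Ψ : L →ₗ[K] (s → K) := LinearMap.pi fun i => x i
  let Φ : L →ₗ[K] (↥sᶜ → K) := LinearMap.pi fun i => x i
  have hΨ : Function.Injective Ψ := by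
    refine (injective_iff_map_eq_zero Ψ).2 fun ξ hξ => hx ξ fun i => ?_
    have hle : Submodule.span K (x '' s) ≤ LinearMap.ker (Module.Dual.eval K L ξ) := by
      refine Submodule.span_le.2 ?_
      rintro _ ⟨j, hj, rfl⟩
      exact congrFun hξ ⟨j, hj⟩
    exact hle (hsp ⟨i, Set.mem_univ i, rfl⟩)
  have hcard : Module.finrank K L = Fintype.card s := by
    refine le_antisymm ?_ ?_
    · simpa using LinearMap.finrank_le_finrank_of_injective hΨ
    · rw [← Subspace.dual_finrank_eq (K := K) (V := L)]
      exact LinearIndependent.fintype_card_le_finrank hli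
  have hΨs : Function.Surjective Ψ :=
    (LinearMap.injective_iff_surjective_of_finrank_eq_finrank (by simpa using hcard)).1 hΨ
  by_contra! hlt
  have hcompl : Fintype.card ↥sᶜ = r - Fintype.card s := by
    rw [Fintype.card_compl_set, Fintype.card_fin]
  have hker : LinearMap.ker Φ ≠ ⊥ :=
    LinearMap.ker_ne_bot_of_finrank_lt (by rw [Module.finrank_pi, hcompl]; omega)
  obtain ⟨v, hv, hv0⟩ := Submodule.exists_mem_ne_zero_of_ne_bot hker
  refine hv0 (hΨ ?_)
  rw [map_zero]
  refine eq_zero_of_forall_sum_add_pow_eq p (a := a) hm hmK fun η => ?_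
  obtain ⟨ξ, rfl⟩ := hΨs η
  have h1 := h (ξ + v)
  have h2 := h ξ
  rw [← Fintype.sum_subtype_add_sum_subtype (fun i => i ∈ s)] at h1 h2
  have h3 : ∑ i : {i // i ∉ s}, x i (ξ + v) ^ (p ^ a * m) =
      ∑ i : {i // i ∉ s}, x i ξ ^ (p ^ a * m) :=
    Finset.sum_congr rfl fun i _ => by
      have : x i v = 0 := congrFun (LinearMap.mem_ker.1 hv) i
      rw [map_add, this, add_zero]
  rw [h3, ← h2] at h1
  simpa [Ψ] using add_right_cancel h1

open Finset in
theorem sum_range_two_mul_eq_zero {M : Type*} [AddCommMonoid M] (f : ℕ → M) (k : ℕ)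
    (h : ∀ i < k, f (2 * i) + f (2 * i + 1) = 0) : ∑ j ∈ range (2 * k), f j = 0 := by
  induction k with
  | zero => simp
  | succ k ih =>
    rw [mul_add_one, sum_range_succ, sum_range_succ, ih fun i hi => h i (by omega), zero_add,
      h k (by omega)]

theorem exists_isotropic {d : ℕ} (hd : d ≠ 0) (r : ℕ) :
    ∃ L : Submodule K (Module.Dual K (Fin r → K)),
      (∀ ξ ∈ L, ∑ i, ξ (Pi.single i 1) ^ d = 0) ∧
      Module.finrank K (Module.Dual K (Fin r → K) ⧸ L) ≤ (r + 1) / 2 := by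
  obtain ⟨ζ, hζ⟩ := IsAlgClosed.exists_pow_nat_eq (-1 : K) (Nat.pos_of_ne_zero hd)
  -- The value 0 beyond r pairs the last coordinate with 0 when r is odd, forcing it to vanish on
  -- the kernel.
  let e : ℕ → Fin r → K := fun j => if h : j < r then Pi.single ⟨j, h⟩ 1 else 0
  let Φ : Module.Dual K (Fin r → K) →ₗ[K] (Fin ((r + 1) / 2) → K) :=
    LinearMap.pi fun i => Module.Dual.eval K _ (e (2 * i + 1) - ζ • e (2 * i))
  refine ⟨LinearMap.ker Φ, fun ξ hξ => ?_, ?_⟩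
  · have hsum : ∑ j ∈ Finset.range (2 * ((r + 1) / 2)), ξ (e j) ^ d = 0 := by
      refine sum_range_two_mul_eq_zero _ _ fun i hi => ?_
      have h := congrFun (LinearMap.mem_ker.1 hξ) ⟨i, hi⟩
      have h' : ξ (e (2 * i + 1)) = ζ * ξ (e (2 * i)) := by
        simpa [Φ, sub_eq_zero] using h
      rw [h', mul_pow, hζ]
      ring
    rw [← hsum, ← Finset.sum_subset (Finset.range_mono (by omega : r ≤ 2 * ((r + 1) / 2))),
      Finset.sum_range]
    · simp [e]
    · intro j _ hj
      simp [e, Finset.mem_range.not.1 hj, hd]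
  · rw [Φ.quotKerEquivRange.finrank_eq]
    simpa using Submodule.finrank_le (LinearMap.range Φ)

theorem nat_ceil_div_two (r : ℕ) : ⌈(r : ℚ) / 2⌉₊ = (r + 1) / 2 := by
  refine le_antisymm (Nat.ceil_le.2 ?_) ?_
  · have h : r ≤ 2 * ((r + 1) / 2) := by omega
    have h' : (r : ℚ) ≤ 2 * (((r + 1) / 2 : ℕ) : ℚ) := by exact_mod_cast h
    linarith
  · have h := Nat.le_ceil ((r : ℚ) / 2)
    have h' : (r : ℚ) ≤ 2 * (⌈(r : ℚ) / 2⌉₊ : ℚ) := by linarith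
    have h'' : r ≤ 2 * ⌈(r : ℚ) / 2⌉₊ := by exact_mod_cast h'
    omega

omit [IsAlgClosed K] in
theorem sliceRank_eq_of_isotropic {V : Type*} [AddCommGroup V] [Module K V]
    [FiniteDimensional K V] {d n : ℕ} {f : SymPow K d V}
    (h : ∃ L : Submodule K (Module.Dual K V), (∀ ξ ∈ L, eval ξ f = 0) ∧
      Module.finrank K (Module.Dual K V ⧸ L) ≤ n)
    (h' : ∀ L : Submodule K (Module.Dual K V), (∀ ξ ∈ L, eval ξ f = 0) →
      n ≤ Module.finrank K (Module.Dual K V ⧸ L)) : sliceRank f = n := by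
  obtain ⟨L, hL, hn⟩ := h
  exact le_antisymm (iInf₂_le_of_le L hL (Nat.cast_le.2 hn))
    (le_iInf₂ fun L hL => Nat.cast_le.2 (h' L hL))

theorem sliceRank_unitTensor (hm : 2 ≤ m) (hmK : (m : K) ≠ 0) (r : ℕ) :
    sliceRank (unitTensor K (p ^ a * m) r) = (((r + 1) / 2 : ℕ) : ℕ∞) := by
  have hd : p ^ a * m ≠ 0 := mul_ne_zero (pow_pos (expChar_pos K p) a).ne' (by omega)
  refine sliceRank_eq_of_isotropic ?_ fun L hL => ?_
  · obtain ⟨L, hL, hfin⟩ := exists_isotropic (K := K) hd r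
    exact ⟨L, fun ξ hξ => by rw [eval_unitTensor, hL ξ hξ], hfin⟩
  · let e := Module.piEquiv (Fin r) K K
    let W : Submodule K (Fin r → K) := L.map e.symm.toLinearMap
    have hsum : ∀ x : W, ∑ i, W.subtype x i ^ (p ^ a * m) = 0 := by
      rintro ⟨_, ξ, hξ, rfl⟩
      have h := hL ξ hξ
      rw [eval_unitTensor] at h
      rw [← h]
      refine Finset.sum_congr rfl fun i _ => ?_
      obtain ⟨y, rfl⟩ := e.surjective ξ
      simp [e, Module.piEquiv_apply_apply, Pi.single_apply]
    have h1 : 2 * Module.finrank K W ≤ r :=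
      two_mul_finrank_le_of_forall_sum_pow_eq_zero (a := a) p hm hmK W.subtype
        W.injective_subtype hsum
    have h2 := L.finrank_quotient_add_finrank
    rw [Subspace.dual_finrank_eq, Module.finrank_fin_fun] at h2
    have h3 : Module.finrank K W = Module.finrank K L := LinearEquiv.finrank_map_eq e.symm L
    omega

end SliceRank

/-! ### Krull dimension and transcendence degree. -/

section Dimension

/-- Lying over and going up lift chains of primes; incomparability keeps contracted chains strict.
-/
theorem ringKrullDim_eq_of_isIntegral {R S : Type*} [CommRing R] [CommRing S] [Algebra R S]
    [Algebra.IsIntegral R S] (hinj : Function.Injective (algebraMap R S)) :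
    ringKrullDim R = ringKrullDim S := by
  refine le_antisymm ?_ ?_
  · refine iSup_le fun l => ?_
    obtain ⟨P, -, hP, hPl⟩ := Ideal.exists_ideal_over_prime_of_isIntegral l.head.asIdeal (⊥ : Ideal S)
      (by rw [Ideal.comap_bot_of_injective _ hinj]; exact bot_le)
    have : P.LiesOver l.head.asIdeal := ⟨hPl.symm⟩
    obtain ⟨l', hl', -⟩ := Ideal.exists_ltSeries_of_hasGoingUp l P
    rw [← hl']
    exact Order.LTSeries.length_le_krullDim l'
  · exact Order.krullDim_le_of_strictMono (PrimeSpectrum.comap (algebraMap R S))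
      fun I J hIJ => Ideal.IsIntegral.comap_lt_comap hIJ

/-- Noether normalization: A is integral over a polynomial ring, which has the same dimension and
transcendence degree. -/
theorem ringKrullDim_eq_of_trdeg_eq {K : Type u} {A : Type v} [Field K] [CommRing A] [IsDomain A]
    [Algebra K A] [Algebra.FiniteType K A] {n : ℕ} (h : Algebra.trdeg K A = n) :
    ringKrullDim A = n := by
  obtain ⟨s, g, hg, hint⟩ := exists_integral_inj_algHom_of_fg K A
  let _ : Algebra (MvPolynomial (Fin s) K) A := g.toRingHom.toAlgebra
  have : Algebra.IsIntegral (MvPolynomial (Fin s) K) A := ⟨hint⟩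
  have : IsScalarTower K (MvPolynomial (Fin s) K) A :=
    IsScalarTower.of_algebraMap_eq fun x => (g.commutes x).symm
  have : FaithfulSMul (MvPolynomial (Fin s) K) A :=
    (faithfulSMul_iff_algebraMap_injective _ _).2 hg
  have htr := lift_trdeg_add_eq K (MvPolynomial (Fin s) K) A
  rw [trdeg_eq_zero (R := MvPolynomial (Fin s) K), h, MvPolynomial.trdeg_of_isDomain] at htr
  have hs : s = n := by simpa using htr
  rw [← ringKrullDim_eq_of_isIntegral (R := MvPolynomial (Fin s) K) hg, ← hs]
  simp [ringKrullDim_eq_zero_of_field]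

end Dimension

/-! ### A differential criterion for dominance. -/

section Tangent

open MvPolynomial

variable {K : Type*} [Field K] {ι : Type*}

theorem aeval_mul_left_of_isHomogeneous {A : Type*} [CommRing A] [Algebra K A]
    {P : MvPolynomial ι K} {n : ℕ} (hP : P.IsHomogeneous n) (t : A) (w : ι → A) :
    aeval (fun i => t * w i) P = t ^ n * aeval w P := by
  rw [aeval_def, aeval_def, eval₂_eq, eval₂_eq, Finset.mul_sum]
  refine Finset.sum_congr rfl fun d hd => ?_
  have hdeg : ∑ i ∈ d.support, d i = n := by
    simpa [Finsupp.weight_apply, Finsupp.sum] using hP (mem_support_iff.1 hd)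
  simp_rw [mul_pow, Finset.prod_mul_distrib, Finset.prod_pow_eq_pow_sum, hdeg]
  ring

theorem eval_aeval_polynomial (w : ι → Polynomial K) (x : K) (P : MvPolynomial ι K) :
    MvPolynomial.eval (fun i => (w i).eval x) P = (aeval w P).eval x := by
  rw [← Polynomial.coe_aeval_eq_eval, comp_aeval_apply, ← coe_aeval_eq_eval]
  rfl

/-- If a polynomial vanishes on a curve through the origin in every tangent direction, it is zero. -/
theorem eq_zero_of_forall_curve_origin [Infinite K] (P : MvPolynomial ι K)
    (h : ∀ v : ι → K, ∃ w : ι → Polynomial K, (∀ i, (w i).eval 0 = v i) ∧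
      aeval (fun i => Polynomial.X * w i) P = 0) : P = 0 := by
  have key : ∀ n, homogeneousComponent n P = 0 := by
    intro n
    induction n using Nat.strong_induction_on with
    | _ n ih =>
      refine MvPolynomial.funext fun v => ?_
      obtain ⟨w, hw, hP⟩ := h v
      by_cases hn : P.totalDegree < n
      · rw [homogeneousComponent_eq_zero _ _ hn]
      -- With the components below degree n already zero, the coefficient of X^n is the degree-n
      -- component at `v`.
      have hsum : ∑ k ∈ Finset.range (P.totalDegree + 1),
          aeval w (homogeneousComponent k P) * Polynomial.X ^ k = 0 := by
        rw [← hP]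
        conv_rhs => rw [← sum_homogeneousComponent P, map_sum]
        refine Finset.sum_congr rfl fun k _ => ?_
        rw [aeval_mul_left_of_isHomogeneous (homogeneousComponent_isHomogeneous k P), mul_comm]
      have hcoeff := congrArg (fun Q => Polynomial.coeff Q n) hsum
      simp only [Polynomial.finsetSum_coeff, Polynomial.coeff_mul_X_pow', Polynomial.coeff_zero]
        at hcoeff
      rw [Finset.sum_eq_single_of_mem n (Finset.mem_range.2 (by omega))] at hcoeff
      · rw [if_pos le_rfl, Nat.sub_self, Polynomial.coeff_zero_eq_eval_zero] at hcoeff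
        rw [map_zero, ← hcoeff, ← eval_aeval_polynomial]
        simp_rw [hw]
      · intro k _ hk
        split_ifs with hkn
        · rw [ih k (by omega)]
          simp
        · rfl
  rw [← sum_homogeneousComponent P]
  exact Finset.sum_eq_zero fun n _ => key n

/-- Translating `c` to the origin reduces to the previous case. Applied to curves in the image of a
map with surjective differential at one point, it shows that the image is Zariski dense. -/
theorem eq_zero_of_forall_curve [Infinite K] (P : MvPolynomial ι K) (c : ι → K)
    (h : ∀ v : ι → K, ∃ G : ι → Polynomial K, (∀ i, (G i).eval 0 = c i) ∧
      (∀ i, (G i).derivative.eval 0 = v i) ∧ aeval G P = 0) : P = 0 := by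
  have hQ : bind₁ (fun i => X i + C (c i)) P = 0 := by
    refine eq_zero_of_forall_curve_origin _ fun v => ?_
    obtain ⟨G, hG, hG', hP⟩ := h v
    refine ⟨fun i => (G i).divX, fun i => ?_, ?_⟩
    · rw [← hG' i]
      conv_rhs => rw [← Polynomial.divX_mul_X_add (G i)]
      simp
    · rw [aeval_bind₁, ← hP]
      congr 2
      funext i
      rw [map_add, aeval_X, aeval_C, ← hG i, ← Polynomial.coeff_zero_eq_eval_zero, mul_comm]
      exact Polynomial.divX_mul_X_add (G i)
  refine MvPolynomial.funext fun x => ?_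
  have hx := congrArg (MvPolynomial.eval fun i => x i - c i) hQ
  rw [map_zero, ← MvPolynomial.coe_aeval_eq_eval, RingHom.coe_coe, aeval_bind₁] at hx
  rw [map_zero, ← MvPolynomial.coe_aeval_eq_eval, RingHom.coe_coe, ← hx]
  simp

end Tangent

/-! ### Values at points over a K-algebra. -/

section EvalAlg

variable {K : Type u} [Field K] {V : Type v} [AddCommGroup V] [Module K V]
  {A : Type w} [CommRing A] [Algebra K A] {d : ℕ}

/-- The value of a symmetric tensor at an `A`-valued point of `V*`. -/
noncomputable def evalAlg (φ : V →ₗ[K] A) : SymPow K d V →ₗ[K] A :=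
  lift ((MultilinearMap.mkPiAlgebra K (ULift.{u} (Fin d)) A).compLinearMap fun _ => φ)
    fun e v => by simpa using Equiv.prod_comp e fun i => φ (v i)

theorem evalAlg_simple (φ : V →ₗ[K] A) (v : Fin d → V) :
    evalAlg φ (simple K v) = ∏ i, φ (v i) :=
  (lift_simple _ _ v).trans (by
    simpa using Equiv.prod_comp (Equiv.ulift.{u} (α := Fin d)) fun i => φ (v i))

end EvalAlg

/-! ### Coordinate rings. -/

section PolyFunctions

variable {K : Type u} [Field K] {W : Type w} [AddCommGroup W] [Module K W]

instance finiteType_polyFunctions [FiniteDimensional K W] (S : Set W) :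
    Algebra.FiniteType K (polyFunctions (K := K) S) := by
  let Λ : Module.Dual K W →ₗ[K] (S → K) := LinearMap.pi fun x => Module.Dual.eval K W x.1
  obtain ⟨t, ht⟩ := Module.Finite.iff_fg.1 (Module.Finite.range Λ)
  have h : polyFunctions (K := K) S = Algebra.adjoin K (t : Set (S → K)) := by
    rw [← Algebra.adjoin_span, ht]
    rfl
  rw [h]
  exact Algebra.FiniteType.adjoin_of_finite t.finite_toSet

/-- The restriction of a linear form to a subset, as a polynomial function. -/
def linearFunction (S : Set W) (ℓ : Module.Dual K W) : polyFunctions (K := K) S :=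
  ⟨fun x => ℓ x.1, Algebra.subset_adjoin ⟨ℓ, rfl⟩⟩

theorem eval_of_aeval_linearFunction_eq_zero {S : Set W} {ι : Type*} {ℓ : ι → Module.Dual K W}
    {P : MvPolynomial ι K} (h : MvPolynomial.aeval (fun i => linearFunction S (ℓ i)) P = 0)
    {x : W} (hx : x ∈ S) : MvPolynomial.eval (fun i => ℓ i x) P = 0 := by
  let ε : polyFunctions (K := K) S →ₐ[K] K :=
    (Pi.evalAlgHom K (fun _ : S => K) ⟨x, hx⟩).comp (polyFunctions (K := K) S).val
  have h' := congrArg ε h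
  rw [MvPolynomial.comp_aeval_apply, map_zero] at h'
  rwa [← MvPolynomial.coe_aeval_eq_eval]

end PolyFunctions

/-! ### Upper bound for the orbit dimension. -/

section Orbit

variable {K : Type u} [Field K] {d r : ℕ}

instance finiteDimensional_symPow {V : Type v} [AddCommGroup V] [Module K V]
    [FiniteDimensional K V] : FiniteDimensional K (SymPow K d V) :=
  Module.Finite.of_surjective (SymmetricPower.mk K (ULift.{u} (Fin d)) V)
    (LinearMap.range_eq_top.1 (SymmetricPower.range_mk K _ V))

theorem map_toLin'_unitTensor (M : Matrix (Fin r) (Fin r) K) :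
    map d (Matrix.toLin' M) (unitTensor K d r) = ∑ k, simple K fun _ : Fin d => M.col k := by
  simp [unitTensor, map_simple]

theorem map_toLin'_mem_glOrbit (f : SymPow K d (Fin r → K)) {M : Matrix (Fin r) (Fin r) K}
    (hM : M.det ≠ 0) : map d (Matrix.toLin' M) f ∈ glOrbit f :=
  ⟨LinearMap.equivOfDetNeZero (Matrix.toLin' M) (by rwa [LinearMap.det_toLin']), by
    congr 2⟩

theorem exists_eq_map_toLin' {f x : SymPow K d (Fin r → K)} (hx : x ∈ glOrbit f) :
    ∃ M : Matrix (Fin r) (Fin r) K, M.det ≠ 0 ∧ x = map d (Matrix.toLin' M) f := by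
  obtain ⟨g, rfl⟩ := hx
  refine ⟨LinearMap.toMatrix' g.toLinearMap, ?_, by rw [Matrix.toLin'_toMatrix']⟩
  rw [LinearMap.det_toMatrix']
  exact (LinearEquiv.isUnit_det' g).ne_zero

variable (K r) in
/-- Evaluation of polynomials in the entries of an invertible matrix. -/
noncomputable def evalGL : MvPolynomial (Fin r × Fin r) K →ₐ[K]
    ({M : Matrix (Fin r) (Fin r) K // M.det ≠ 0} → K) :=
  AlgHom.pi fun M => MvPolynomial.aeval fun ij => M.1 ij.1 ij.2

theorem evalGL_apply (P : MvPolynomial (Fin r × Fin r) K)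
    (M : {M : Matrix (Fin r) (Fin r) K // M.det ≠ 0}) :
    evalGL K r P M = MvPolynomial.eval (fun ij => M.1 ij.1 ij.2) P := by
  rw [← MvPolynomial.coe_aeval_eq_eval]
  rfl

theorem evalGL_injective [Infinite K] : Function.Injective (evalGL K r) := by
  refine (injective_iff_map_eq_zero _).2 fun P hP => ?_
  have hdet := Matrix.det_mvPolynomialX_ne_zero (Fin r) K
  -- P vanishes on invertible matrices, so P · det vanishes everywhere.
  refine (mul_eq_zero.1 (MvPolynomial.funext fun x => ?_ :
    P * (Matrix.mvPolynomialX (Fin r) (Fin r) K).det = 0)).resolve_right hdet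
  let M : Matrix (Fin r) (Fin r) K := fun i j => x (i, j)
  have hM : MvPolynomial.eval x (Matrix.mvPolynomialX (Fin r) (Fin r) K).det = M.det := by
    rw [RingHom.map_det]
    congr 1
    ext i j
    simp [M]
  rw [map_mul, map_zero, hM, mul_eq_zero]
  by_cases h : M.det = 0
  · exact Or.inr h
  · left
    have h' := congrFun hP ⟨M, h⟩
    rwa [evalGL_apply] at h'

theorem apply_simple_col_mem_range_evalGL (ℓ : Module.Dual K (SymPow K d (Fin r → K)))
    (k : Fin r) :
    (fun M : {M : Matrix (Fin r) (Fin r) K // M.det ≠ 0} =>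
      ℓ (simple K fun _ : Fin d => M.1.col k)) ∈ (evalGL K r).range := by
  classical
  have hcol : ∀ M : Matrix (Fin r) (Fin r) K, M.col k = ∑ j, M j k • (Pi.single j 1 : Fin r → K) :=
    fun M => by
      ext i
      simp [Finset.sum_apply, Pi.single_apply]
  refine ⟨∑ φ : ULift.{u} (Fin d) → Fin r, (∏ a, MvPolynomial.X (φ a, k)) *
    MvPolynomial.C (ℓ (SymmetricPower.tprod K fun a => Pi.single (φ a) 1)), ?_⟩
  funext M
  change evalGL K r _ M = _
  rw [evalGL_apply, simple, hcol, MultilinearMap.map_sum, map_sum, map_sum]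
  refine Finset.sum_congr rfl fun φ _ => ?_
  rw [MultilinearMap.map_smul_univ, map_smul, map_mul, map_prod]
  simp

theorem exists_injective_algHom_polyFunctions_glOrbit [Infinite K] :
    ∃ φ : polyFunctions (K := K) (glOrbit (unitTensor K d r)) →ₐ[K]
      MvPolynomial (Fin r × Fin r) K, Function.Injective φ := by
  let S := glOrbit (unitTensor K d r)
  let π : {M : Matrix (Fin r) (Fin r) K // M.det ≠ 0} → S := fun M =>
    ⟨map d (Matrix.toLin' M.1) (unitTensor K d r), map_toLin'_mem_glOrbit _ M.2⟩
  have hπ : Function.Surjective π := fun x => by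
    obtain ⟨M, hM, hx⟩ := exists_eq_map_toLin' x.2
    exact ⟨⟨M, hM⟩, Subtype.ext hx.symm⟩
  let Ψ : (S → K) →ₐ[K] ({M : Matrix (Fin r) (Fin r) K // M.det ≠ 0} → K) :=
    AlgHom.pi fun M => Pi.evalAlgHom K (fun _ : S => K) (π M)
  have hΨ : Function.Injective Ψ := hπ.injective_comp_right
  have hle : polyFunctions (K := K) S ≤ (evalGL K r).range.comap Ψ := by
    refine Algebra.adjoin_le ?_
    rintro _ ⟨ℓ, rfl⟩
    change (fun M : {M : Matrix (Fin r) (Fin r) K // M.det ≠ 0} =>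
      ℓ (map d (Matrix.toLin' M.1) (unitTensor K d r))) ∈ (evalGL K r).range
    have h : (fun M : {M : Matrix (Fin r) (Fin r) K // M.det ≠ 0} =>
        ℓ (map d (Matrix.toLin' M.1) (unitTensor K d r))) =
        ∑ k, fun M : {M : Matrix (Fin r) (Fin r) K // M.det ≠ 0} =>
          ℓ (simple K fun _ : Fin d => M.1.col k) := by
      funext M
      rw [map_toLin'_unitTensor, map_sum, Finset.sum_apply]
    rw [h]
    exact sum_mem fun k _ => apply_simple_col_mem_range_evalGL ℓ k
  refine ⟨(AlgEquiv.ofInjective (evalGL K r) evalGL_injective).symm.toAlgHom.comp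
    ((Ψ.comp (polyFunctions (K := K) S).val).codRestrict _ fun x => hle x.2), ?_⟩
  refine (AlgEquiv.injective (AlgEquiv.ofInjective (evalGL K r) evalGL_injective).symm).comp
    fun x y hxy => Subtype.ext (hΨ ?_)
  exact congrArg Subtype.val hxy

end Orbit

/-! ### Lower bound: independent functions on the orbit. -/

section Coordinates

open Polynomial

variable {K : Type u} [Field K] {r : ℕ}

theorem coeff_one_add_X_mul_pow (m : ℕ) (x y : K) :
    ((C x + X * C y) ^ m).coeff 1 = m * (x ^ (m - 1) * y) := by
  have h := coeff_derivative ((C x + X * C y) ^ m) 0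
  rw [coeff_zero_eq_eval_zero] at h
  simp only [derivative_pow, zero_add, Nat.cast_zero, mul_one] at h
  rw [← h]
  simp
  ring

/-- The power is a polynomial in X^q, so this is a linear coefficient of an m-th power after
Frobenius. -/
theorem coeff_add_X_mul_pow (p : ℕ) [ExpChar K p] (a m : ℕ) (x y : K) :
    ((C x + X * C y) ^ (p ^ a * m)).coeff (p ^ a) = m * (x ^ (m - 1) * y) ^ p ^ a := by
  have hq : 0 < p ^ a := pow_pos (expChar_pos K p) a
  have h : (C x + X * C y) ^ (p ^ a * m) =
      expand K (p ^ a) ((C (x ^ p ^ a) + X * C (y ^ p ^ a)) ^ m) := by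
    rw [pow_mul, add_pow_expChar_pow, mul_pow, map_pow, map_add, map_mul, expand_C, expand_C,
      expand_X, C_pow, C_pow]
  have h' := coeff_expand_mul hq ((C (x ^ p ^ a) + X * C (y ^ p ^ a)) ^ m) 1
  rw [one_mul] at h'
  rw [h, h', coeff_one_add_X_mul_pow, mul_pow, ← pow_mul, ← pow_mul, mul_comm (p ^ a)]

/-- The linear map sending `v` to the polynomial `v i + v j * X`. -/
noncomputable def pencil (i j : Fin r) : (Fin r → K) →ₗ[K] K[X] :=
  Algebra.linearMap K K[X] ∘ₗ LinearMap.proj i +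
    LinearMap.mulLeft K (X : K[X]) ∘ₗ Algebra.linearMap K K[X] ∘ₗ LinearMap.proj j

theorem coeff_evalAlg_pencil (p : ℕ) [ExpChar K p] (a m : ℕ) (i j : Fin r)
    (M : Matrix (Fin r) (Fin r) K) :
    (evalAlg (pencil i j)
      (map (p ^ a * m) (Matrix.toLin' M) (unitTensor K (p ^ a * m) r))).coeff (p ^ a) =
      m * (∑ k, M i k ^ (m - 1) * M j k) ^ p ^ a := by
  rw [map_toLin'_unitTensor, map_sum, finsetSum_coeff, sum_pow_char_pow, Finset.mul_sum]
  refine Finset.sum_congr rfl fun k _ => ?_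
  rw [evalAlg_simple, Finset.prod_const, Finset.card_univ, Fintype.card_fin,
    ← coeff_add_X_mul_pow]
  rfl

/-- The curve `1 + t N` in the space of matrices. -/
noncomputable def matrixLine (N : Matrix (Fin r) (Fin r) K) (i k : Fin r) : K[X] :=
  C ((1 : Matrix (Fin r) (Fin r) K) i k) + X * C (N i k)

theorem derivative_sum_matrixLine {m : ℕ} (hm : 3 ≤ m) (N : Matrix (Fin r) (Fin r) K)
    (i j : Fin r) :
    (derivative (∑ k, matrixLine N i k ^ (m - 1) * matrixLine N j k)).eval 0 =
      N j i + if i = j then ((m - 1 : ℕ) : K) * N i i else 0 := by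
  have h1 : m - 1 ≠ 0 := by omega
  -- Here m ≥ 3 enters: the factor M_ik^(m-2) vanishes at the identity for k ≠ i.
  have h2 : m - 1 - 1 ≠ 0 := by omega
  simp only [derivative_sum, eval_finsetSum, matrixLine, derivative_mul, derivative_pow]
  rw [Finset.sum_eq_single i]
  · by_cases hij : i = j
    · subst hij
      simp
      ring
    · simp [Matrix.one_apply_ne' hij, hij]
  · intro k _ hk
    simp [Matrix.one_apply_ne' hk, h1, h2]
  · simp

theorem eq_zero_of_forall_eval_sum [Infinite K] {m : ℕ} (hm : 3 ≤ m) (hmK : (m : K) ≠ 0)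
    (P : MvPolynomial (Fin r × Fin r) K)
    (h : ∀ M : Matrix (Fin r) (Fin r) K, M.det ≠ 0 →
      MvPolynomial.eval (fun ij => ∑ k, M ij.1 k ^ (m - 1) * M ij.2 k) P = 0) : P = 0 := by
  refine eq_zero_of_forall_curve P
    (fun ij => ∑ k, (1 : Matrix (Fin r) (Fin r) K) ij.1 k ^ (m - 1) *
      (1 : Matrix (Fin r) (Fin r) K) ij.2 k) fun v => ?_
  -- The inverse of the differential at 1: transpose, dividing the diagonal by m = 1 + (m-1).
  let N : Matrix (Fin r) (Fin r) K := fun j i => if i = j then v (i, i) / m else v (i, j)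
  let G : Fin r × Fin r → K[X] := fun ij =>
    ∑ k, matrixLine N ij.1 k ^ (m - 1) * matrixLine N ij.2 k
  refine ⟨G, fun ij => ?_, fun ij => ?_, ?_⟩
  · simp [G, matrixLine, eval_finsetSum]
  · obtain ⟨i, j⟩ := ij
    rw [derivative_sum_matrixLine hm]
    by_cases hij : i = j
    · subst hij
      simp only [N, if_true, Nat.cast_pred (by omega : 0 < m)]
      field_simp
      ring
    · simp [N, hij]
  · let D : K[X] := (Matrix.of (matrixLine N)).det
    have hD : ∀ t, D.eval t = (Matrix.of fun i k => (matrixLine N i k).eval t).det := fun t => by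
      rw [← coe_evalRingHom, RingHom.map_det]
      rfl
    have hD0 : D ≠ 0 := fun h0 => by
      have h1 := hD 0
      have h2 : (Matrix.of fun i k => (matrixLine N i k).eval 0) = 1 := by
        ext i k
        simp [matrixLine]
      rw [h0, h2] at h1
      simp at h1
    refine (mul_eq_zero.1 (Polynomial.funext fun t => ?_ :
      MvPolynomial.aeval G P * D = 0)).resolve_right hD0
    rw [eval_mul, eval_zero, mul_eq_zero]
    by_cases ht : D.eval t = 0
    · exact Or.inr ht
    · left
      rw [hD] at ht
      rw [← eval_aeval_polynomial, ← h _ ht]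
      simp [G, eval_finsetSum]

theorem algebraicIndependent_coordinates [IsAlgClosed K] (p : ℕ) [ExpChar K p] {a m : ℕ}
    (hm : 3 ≤ m) (hmK : (m : K) ≠ 0) :
    AlgebraicIndependent K fun ij : Fin r × Fin r =>
      linearFunction (glOrbit (unitTensor K (p ^ a * m) r))
        (lcoeff K (p ^ a) ∘ₗ evalAlg (pencil ij.1 ij.2)) := by
  have hq : 0 < p ^ a := pow_pos (expChar_pos K p) a
  refine algebraicIndependent_iff.2 fun P hP => ?_
  have hQ : MvPolynomial.bind₁ (fun ij => MvPolynomial.C (m : K) * MvPolynomial.X ij ^ p ^ a) P =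
      0 := by
    refine eq_zero_of_forall_eval_sum hm hmK _ fun M hM => ?_
    rw [← eval_of_aeval_linearFunction_eq_zero hP (map_toLin'_mem_glOrbit _ hM),
      ← MvPolynomial.coe_aeval_eq_eval, ← MvPolynomial.coe_aeval_eq_eval, RingHom.coe_coe,
      RingHom.coe_coe, MvPolynomial.aeval_bind₁]
    congr 2
    funext ij
    rw [LinearMap.comp_apply, lcoeff_apply, coeff_evalAlg_pencil]
    simp
  refine MvPolynomial.funext fun x => ?_
  -- Solving m y^q = x shows that the substitution hits every point.
  choose y hy using fun ij => IsAlgClosed.exists_pow_nat_eq (x ij / m) hq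
  have hx := congrArg (MvPolynomial.eval y) hQ
  rw [map_zero, ← MvPolynomial.coe_aeval_eq_eval, RingHom.coe_coe, MvPolynomial.aeval_bind₁] at hx
  rw [map_zero, ← MvPolynomial.coe_aeval_eq_eval, RingHom.coe_coe, ← hx]
  congr 2
  funext ij
  simp only [map_mul, map_pow, MvPolynomial.aeval_C, MvPolynomial.aeval_X, hy,
    Algebra.algebraMap_self, RingHom.id_apply]
  field_simp

end Coordinates

theorem varietyDim_glOrbit_unitTensor {K : Type u} [Field K] [IsAlgClosed K] (p : ℕ) [ExpChar K p]
    {a m : ℕ} (hm : 3 ≤ m) (hmK : (m : K) ≠ 0) (r : ℕ) :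
    varietyDim K (glOrbit (unitTensor K (p ^ a * m) r)) = ((r ^ 2 : ℕ) : WithBot ℕ∞) := by
  obtain ⟨φ, hφ⟩ := exists_injective_algHom_polyFunctions_glOrbit (K := K) (d := p ^ a * m) (r := r)
  have : IsDomain (polyFunctions (K := K) (glOrbit (unitTensor K (p ^ a * m) r))) :=
    hφ.isDomain φ.toRingHom
  have htr : Algebra.trdeg K (polyFunctions (K := K) (glOrbit (unitTensor K (p ^ a * m) r))) =
      (r ^ 2 : ℕ) := by
    refine le_antisymm ?_ ?_
    · refine (trdeg_le_of_injective φ hφ).trans ?_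
      rw [MvPolynomial.trdeg_of_isDomain]
      simp [sq]
    · have h := (algebraicIndependent_coordinates (r := r) (a := a) p hm hmK).lift_cardinalMk_le_trdeg
      simpa [sq] using h
  exact ringKrullDim_eq_of_trdeg_eq htr

end SymSubrank

theorem proposition2p1 (K : Type*) [Field K] [IsAlgClosed K] (p : ℕ) [ExpChar K p] (d : ℕ)
    (hd : ∀ k : ℕ, d ≠ p ^ k * 0 ∧ d ≠ p ^ k * 1 ∧ d ≠ p ^ k * 2) (r : ℕ) :
    (∀ U : Submodule K (Fin r → K), U ≠ ⊤ →
      SymSubrank.unitTensor K d r ∉ SymSubrank.symPowOf d U) ∧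
    SymSubrank.sliceRank (SymSubrank.unitTensor K d r) = ((⌈(r : ℚ) / 2⌉₊ : ℕ) : ℕ∞) ∧
    SymSubrank.varietyDim K (SymSubrank.glOrbit (SymSubrank.unitTensor K d r)) =
      ((r ^ 2 : ℕ) : WithBot ℕ∞) := by
  obtain ⟨a, m, rfl, hm, hmK⟩ := SymSubrank.exists_eq_expChar_pow_mul K p hd
  refine ⟨fun U hU => SymSubrank.unitTensor_notMem_symPowOf p (by omega) hmK hU, ?_,
    SymSubrank.varietyDim_glOrbit_unitTensor p hm hmK r⟩
  rw [SymSubrank.nat_ceil_div_two, SymSubrank.sliceRank_unitTensor p (by omega) hmK]
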